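/- A graph is a finite nonempty vertex set together with a finite multiset of edges (loops and parallel edges allowed). Each edge of a graph $X$, also a loop, gives two mutually inverse arcs $e,\bar e$. A cycle is a nonempty closed sequence $(e_1,\dots,e_n)$ of arcs in which each arc ends where the (cyclically) next one begins; it is without backtracking or tail if $e_{i}\neq\overline{e_{i+1}}$ for $1\le i\le n-1$ and $e_1\ne\overline{e_n}$; it is primitive if it is not the $r$-fold repetition of a cycle for any $r\ge 2$. A prime cycle $[c]$ is the class up to cyclic permutation of a primitive cycle without backtracking or tail. Attaching a complex variable $u_e$ to each arc, the edge zeta function is $$\zeta_X(\vec u)=\prod_{[c]}\Bigl(1-\prod_{e\text{ in }c}u_e\Bigr)^{-1},$$ the outer product being over all prime cycles and $\vec u$ being close to $0$. Let $s_e(W,X)$ (resp. $s_v(W,X)$) be the number of edge-induced (resp. vertex-induced) subgraphs of $X$ isomorphic to $W$, and let the clique number $\omega(X)$ be the largest $r$ such that $X$ has a vertex-induced subgraph isomorphic to the complete graph $K_r$ ($0$ if there is none). **Corollary (Complete graphs and the clique number).** Let $X$ and $Y$ be graphs whose arcs are labelled injectively by variables from a common finite set $\{u_i\}_{i\in I}$,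 such that the labels of inverse arcs are exchanged by one and the same map $I\to I$ for both graphs. Suppose that $\zeta_X(\vec u)=\zeta_Y(\vec u)$ for all $\vec u\in\mathbb C^I$ in a neighbourhood of $0$. Then for every $r\ge 3$ (the numbers below vanish if $r$ exceeds the number of vertices) $$s_e(K_r,X)=s_e(K_r,Y),\qquad s_v(K_r,X)=s_v(K_r,Y),$$ if $X$ is simple, then $s_e(K_r,X)=s_v(K_r,X)$, and $\omega(X)=r$ if and only if $\omega(Y)=r$. If moreover $X$ and $Y$ are simple and either both or neither of them have an edge (in particular, if both zeta functions are functions of the same set of variables), then $\omega(X)=\omega(Y)$. -/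

import Mathlib

/-! Graphs are Mathlib's multigraphs `Graph α β`: loops and parallel edges are allowed. -/

namespace Graph

noncomputable section

/-- The arcs of the symmetric digraph `D(X)`: every edge (a loop as well) gives two mutually
inverse arcs. -/
@[ext]
structure Arc {α β : Type*} (X : Graph α β) where
  edge : X.edgeSet
  flip : Bool

/-- The ends of an edge, in a chosen order. -/
def ends {α β : Type*} (X : Graph α β) (e : X.edgeSet) : α × α :=
  ⟨(X.exists_isLink_of_mem_edgeSet e.2).choose,
    (X.exists_isLink_of_mem_edgeSet e.2).choose_spec.choose⟩

theorem isLink_ends {α β : Type*} (X : Graph α β) (e : X.edgeSet) :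
    X.IsLink e (X.ends e).1 (X.ends e).2 :=
  (X.exists_isLink_of_mem_edgeSet e.2).choose_spec.choose_spec

/-- The inverse arc. -/
def Arc.inv {α β : Type*} {X : Graph α β} (a : X.Arc) : X.Arc := ⟨a.edge, !a.flip⟩

/-- The origin of an arc. -/
def Arc.origin {α β : Type*} {X : Graph α β} (a : X.Arc) : α :=
  if a.flip then (X.ends a.edge).2 else (X.ends a.edge).1

/-- The terminus of an arc. -/
def Arc.terminus {α β : Type*} {X : Graph α β} (a : X.Arc) : α :=
  if a.flip then (X.ends a.edge).1 else (X.ends a.edge).2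

/-- A cycle `(e₁, …, eₙ)`, `n ≥ 1`: `t(eᵢ) = o(eᵢ₊₁)` for `i < n` and `t(eₙ) = o(e₁)`. -/
def IsArcCycle {α β : Type*} (X : Graph α β) (c : List X.Arc) : Prop :=
  c.IsChain (fun e f => e.terminus = f.origin) ∧
    ∃ h : c ≠ [], (c.getLast h).terminus = (c.head h).origin

/-- The sequence `c` has backtracking: `eᵢ` is the inverse of `eᵢ₊₁` for some `i < n`. -/
def HasBacktracking {α β : Type*} (X : Graph α β) (c : List X.Arc) : Prop :=
  ¬ c.IsChain (fun e f => f.inv ≠ e)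

/-- The sequence `c` has a tail: `e₁` is the inverse of `eₙ`. -/
def HasTail {α β : Type*} (X : Graph α β) (c : List X.Arc) : Prop :=
  ∃ h : c ≠ [], c.head h = (c.getLast h).inv

/-- The cycle `c` is primitive: it is not the `r`-multiple of a cycle `b` with `r ≥ 2`. -/
def IsPrimitive {α β : Type*} (X : Graph α β) (c : List X.Arc) : Prop :=
  ∀ (b : List X.Arc) (r : ℕ), X.IsArcCycle b → 2 ≤ r → c ≠ (List.replicate r b).flatten

/-- Prime cycles: classes, up to cyclic permutation, of primitive cycles without backtracking or
tail.  (Mathlib's `Cycle A` is the type of lists over `A` up to rotation.) -/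
def PrimeCycle {α β : Type*} (X : Graph α β) : Type _ :=
  {C : Cycle X.Arc // ∃ c : List X.Arc, (c : Cycle X.Arc) = C ∧
    X.IsArcCycle c ∧ ¬ X.HasBacktracking c ∧ ¬ X.HasTail c ∧ X.IsPrimitive c}

/-- The product of the `u_e` over the arcs `e` of a prime cycle, with multiplicity. -/
def PrimeCycle.weight {α β : Type*} {X : Graph α β} (C : X.PrimeCycle) (u : X.Arc → ℂ) : ℂ :=
  (C.1.toMultiset.map u).prod

/-- The edge zeta function `ζ_X(u) = ∏_{[c]} (1 - g(c))⁻¹`, the product being over all prime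
cycles.  For a finite graph the product converges absolutely for `u` near `0`. -/
def edgeZeta {α β : Type*} (X : Graph α β) (u : X.Arc → ℂ) : ℂ :=
  ∏' C : X.PrimeCycle, (1 - C.weight u)⁻¹

/-- Isomorphisms of multigraphs. -/
structure Iso {α β α' β' : Type*} (G : Graph α β) (H : Graph α' β') where
  vertexEquiv : G.vertexSet ≃ H.vertexSet
  edgeEquiv : G.edgeSet ≃ H.edgeSet
  isLink_iff : ∀ (e : G.edgeSet) (x y : G.vertexSet),
    H.IsLink (edgeEquiv e) (vertexEquiv x) (vertexEquiv y) ↔ G.IsLink e x y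

/-- The edge-induced subgraph `⟨R⟩`: its edges are those in `R`, its vertices are the vertices
incident to some edge in `R`. -/
def edgeInduce {α β : Type*} (X : Graph α β) (R : Set β) : Graph α β :=
  (X.restrict R).induce {x | ∃ e ∈ R, X.Inc e x}

/-- `s_v(W, X)`: the number of vertex-induced subgraphs of `X` isomorphic to `W`. -/
def vertexInducedCount {α β α' β' : Type*} (W : Graph α' β') (X : Graph α β) : ℕ :=
  {S : Set α | S ⊆ X.vertexSet ∧ Nonempty (Iso (X.induce S) W)}.ncard

/-- `s_e(W, X)`: the number of edge-induced subgraphs of `X` isomorphic to `W`. -/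
def edgeInducedCount {α β α' β' : Type*} (W : Graph α' β') (X : Graph α β) : ℕ :=
  {R : Set β | R ⊆ X.edgeSet ∧ Nonempty (Iso (X.edgeInduce R) W)}.ncard

/-- The complete graph `K_r`. -/
def complete (r : ℕ) : Graph (Fin r) (Sym2 (Fin r)) :=
  Graph.ofSimpleGraph (⊤ : SimpleGraph (Fin r))

/-- The clique number: the largest `r` such that `X` has a vertex-induced subgraph isomorphic
to `K_r`. -/
def cliqueNumber {α β : Type*} (X : Graph α β) : ℕ :=
  sSup {r : ℕ | ∃ S : Set α, S ⊆ X.vertexSet ∧ Nonempty (Iso (X.induce S) (complete r))}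

end

end Graph

/-! The zeta functions are used only through the label sets of their prime cycles. Putting `u i = t`
on a set `S` and `0` elsewhere keeps exactly the primes with labels in `S`. Inclusion-exclusion over
subsets isolates the primes with label set exactly `T`; for small `t > 0` each contributes a
positive amount to the logarithm, so the zeta function decides whether such a prime exists
(`SameZeta.isPrimeSupport_iff`).

These label sets determine the triangles. The labels of a directed triangle of `X` are those of a
prime of `Y`. A vertex-simple cycle inside that prime is again prime, so its labels are those of a
prime of `X` inside the triangle, and a cycle there uses all three arcs. Hence the three labels form
a simple 3-cycle in `Y`. Its cyclic order may be reversed, so only undirected triangles are compared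
(`SameZeta.isTriangle`). A loop at a vertex of a triangle is detected by the prime running through
both (`SameZeta.exists_loop`).

For `r ≥ 3` every edge of a `K_r` lies in a triangle, so its edges have partners in `Y`, and edges
at a common vertex have partners that meet pairwise. As in Whitney's theorem on line graphs, three
such partners could form a triangle instead of a star; transferring that triangle back to `X` rules
this out, so `K_r` goes to `K_r` (`SameZeta.exists_isCompleteSub`). An additional parallel edge
would create another triangle, and an additional loop is detected as above, so induced copies go to
induced copies (`SameZeta.isFull`). Both kinds of copies are counted by their edge sets, which are
transported injectively in both directions. Clique numbers below 3 of nonempty simple graphs are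
told apart by the existence of an edge. -/

open Filter Topology

namespace Graph

/-! ### Arcs, and criteria for a cycle to be prime. -/

section Arcs

variable {α β : Type*} {X : Graph α β}

theorem Arc.inv_inv (a : X.Arc) : a.inv.inv = a := by
  cases a; simp [Arc.inv]

theorem Arc.inv_ne (a : X.Arc) : a.inv ≠ a := by
  cases a; simp [Arc.inv]

@[simp]
theorem Arc.edge_inv (a : X.Arc) : a.inv.edge = a.edge := rfl

theorem Arc.origin_inv (a : X.Arc) : a.inv.origin = a.terminus := by
  rcases a with ⟨e, _ | _⟩ <;> simp [Arc.inv, Arc.origin, Arc.terminus]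

theorem Arc.terminus_inv (a : X.Arc) : a.inv.terminus = a.origin := by
  rcases a with ⟨e, _ | _⟩ <;> simp [Arc.inv, Arc.origin, Arc.terminus]

theorem Arc.eq_or_eq_inv {a b : X.Arc} (h : a.edge = b.edge) : a = b ∨ a = b.inv := by
  rcases a with ⟨e, _ | _⟩ <;> rcases b with ⟨f, _ | _⟩ <;> simp_all [Arc.inv]

theorem Arc.isLink (a : X.Arc) : X.IsLink a.edge a.origin a.terminus := by
  rcases a with ⟨e, _ | _⟩
  · simpa [Arc.origin, Arc.terminus] using X.isLink_ends e
  · simpa [Arc.origin, Arc.terminus] using (X.isLink_ends e).symm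

theorem IsLink.exists_arc {e : β} {x y : α} (h : X.IsLink e x y) :
    ∃ a : X.Arc, (a.edge : β) = e ∧ a.origin = x ∧ a.terminus = y := by
  have h0 := X.isLink_ends ⟨e, h.edge_mem⟩
  rcases h.eq_and_eq_or_eq_and_eq h0 with ⟨h1, h2⟩ | ⟨h1, h2⟩
  · exact ⟨⟨⟨e, h.edge_mem⟩, false⟩, rfl, by simp [Arc.origin, h1], by simp [Arc.terminus, h2]⟩
  · exact ⟨⟨⟨e, h.edge_mem⟩, true⟩, rfl, by simp [Arc.origin, h1], by simp [Arc.terminus, h2]⟩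

theorem finite_arc (hE : X.edgeSet.Finite) : Finite X.Arc := by
  have := hE.to_subtype
  refine Finite.of_injective (fun a : X.Arc => (a.edge, a.flip)) fun a b h => ?_
  simp only [Prod.mk.injEq] at h
  exact Arc.ext h.1 h.2

/-- Representatives of prime cycles. -/
def IsPrimeArcCycle (X : Graph α β) (c : List X.Arc) : Prop :=
  X.IsArcCycle c ∧ ¬ X.HasBacktracking c ∧ ¬ X.HasTail c ∧ X.IsPrimitive c

theorem isPrimitive_of_nodup {c : List X.Arc} (hc : c.Nodup) : X.IsPrimitive c := by
  rintro b r ⟨-, hb, -⟩ hr rfl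
  obtain ⟨a, ha⟩ := List.exists_mem_of_ne_nil b hb
  obtain ⟨r, rfl⟩ := Nat.exists_eq_add_of_le hr
  rw [List.replicate_add] at hc
  simp only [List.replicate_succ, List.replicate_zero, List.flatten_append, List.flatten_cons,
    List.flatten_nil, List.append_nil] at hc
  exact List.disjoint_of_nodup_append (List.Nodup.of_append_left hc) ha ha

/-- Backtracking or a tail would put an arc and its inverse into `c`, and a proper repetition would
repeat an arc. All primes constructed below are obtained in this way. -/
theorem isPrimeArcCycle_of_nodup {c : List X.Arc} (h : X.IsArcCycle c) (hc : c.Nodup)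
    (hinv : ∀ a ∈ c, a.inv ∉ c) : X.IsPrimeArcCycle c := by
  refine ⟨h, not_not.2 ?_, ?_, isPrimitive_of_nodup hc⟩
  · refine List.IsChain.imp_of_mem_imp ?_ h.1
    rintro a b ha hb - rfl
    exact hinv b hb ha
  · rintro ⟨h0, h1⟩
    exact hinv _ (List.getLast_mem h0) (h1 ▸ List.head_mem h0)

/-- A shortest cycle among those contained in a set of arcs passes through every vertex at most
once. -/
theorem IsArcCycle.exists_nodup_origin {d : List X.Arc} (hd : X.IsArcCycle d) :
    ∃ c : List X.Arc, X.IsArcCycle c ∧ c ⊆ d ∧ (c.map Arc.origin).Nodup := by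
  induction hn : d.length using Nat.strong_induction_on generalizing d with
  | _ n ih =>
  by_cases hnd : (d.map Arc.origin).Nodup
  · exact ⟨d, hd, fun _ h => h, hnd⟩
  obtain ⟨i, j, hij, hj, hor⟩ : ∃ (i j : ℕ) (hij : i < j) (hj : j < d.length),
      (d[i]'(hij.trans hj)).origin = d[j].origin := by
    by_contra! hcon
    refine hnd (List.pairwise_iff_getElem.2 fun i j hi hj hij => ?_)
    simp only [List.length_map] at hi hj
    simpa using hcon i j hij hj
  have hlen : ((d.drop i).take (j - i)).length = j - i := by simp; omega
  have hne : (d.drop i).take (j - i) ≠ [] := by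
    intro h0; rw [h0] at hlen; simp at hlen; omega
  have hsub : (d.drop i).take (j - i) ⊆ d :=
    fun a ha => List.mem_of_mem_drop (List.mem_of_mem_take ha)
  -- The segment from index `i` to `j - 1` closes up: its last arc ends at the origin of `d[j]`,
  -- which is the origin of `d[i]`.
  obtain ⟨c, hc, hcd, hcn⟩ := ih (j - i) (by omega) (d := (d.drop i).take (j - i))
    ⟨(hd.1.drop i).take _, hne, by
      rw [List.getLast_eq_getElem, List.head_eq_getElem]
      simp only [List.getElem_take, List.getElem_drop, hlen]
      have := List.isChain_iff_getElem.1 hd.1 (i + (j - i - 1)) (by omega)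
      rw [this]
      simp only [add_zero, hor]
      congr 2; omega⟩ hlen
  exact ⟨c, hc, fun a ha => hsub (hcd ha), hcn⟩

/-- If no arc of a chain leaves or enters `P`, then either all of its arcs start in `P` or none
does. -/
theorem origin_mem_iff_of_isChain {c : List X.Arc}
    (hc : c.IsChain (fun e f => e.terminus = f.origin)) (P : α → Prop)
    (h : ∀ a ∈ c, P a.origin ↔ P a.terminus) :
    ∀ a ∈ c, ∀ b ∈ c, P a.origin ↔ P b.origin := by
  induction c with
  | nil => simp
  | cons x l ih =>
    have hx : ∀ b ∈ l, P x.origin ↔ P b.origin := by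
      intro b hb
      cases l with
      | nil => simp at hb
      | cons y m =>
        rw [List.isChain_cons_cons] at hc
        rw [h x (by simp), hc.1]
        exact ih hc.2 (fun a ha => h a (by simp [ha])) y (by simp) b hb
    have hl := ih hc.tail fun a ha => h a (by simp [ha])
    intro a ha b hb
    rcases List.mem_cons.1 ha with rfl | ha' <;> rcases List.mem_cons.1 hb with rfl | hb'
    · rfl
    · exact hx b hb'
    · exact (hx a ha').symm
    · exact hl a ha' b hb'

end Arcs

end Graph

/-! ### Convergence of the Euler product and its logarithm. -/

theorem summable_pow_length {A : Type*} [Fintype A] {t : ℝ} (ht : 0 ≤ t)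
    (h : Fintype.card A * t < 1) : Summable fun l : List A => t ^ l.length := by
  rw [← List.equivSigmaTuple.symm.summable_iff]
  have h1 : ((fun l : List A => t ^ l.length) ∘ List.equivSigmaTuple.symm) =
      fun s : Σ n, Fin n → A => t ^ s.1 := by
    ext s; simp [List.equivSigmaTuple]
  rw [h1, summable_sigma_of_nonneg fun s => pow_nonneg ht _]
  refine ⟨fun n => (hasSum_fintype _).summable, ?_⟩
  -- There are `card A ^ n` words of length `n`, so the sum over lengths is geometric.
  simp only [tsum_fintype, Finset.sum_const, Finset.card_univ, Fintype.card_fun, Fintype.card_fin,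
    nsmul_eq_mul, Nat.cast_pow, ← mul_pow]
  exact summable_geometric_of_lt_one (by positivity) h

theorem neg_log_one_sub_le {x : ℝ} (h0 : 0 ≤ x) (h1 : x ≤ 1 / 2) : -Real.log (1 - x) ≤ 2 * x := by
  have h2 := Real.one_sub_inv_le_log_of_pos (x := 1 - x) (by linarith)
  have h3 : (1 - x)⁻¹ ≤ 1 + 2 * x := by
    rw [inv_le_iff_one_le_mul₀ (by linarith)]
    nlinarith
  linarith

namespace Graph

noncomputable section

section Zeta

variable {α β I : Type*} {X : Graph α β}

/-- The length of a prime cycle. -/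
def PrimeCycle.length (C : X.PrimeCycle) : ℕ := Multiset.card C.1.toMultiset

/-- The set of labels of the arcs of a prime cycle. -/
def PrimeCycle.labels [DecidableEq I] (v : X.Arc → I) (C : X.PrimeCycle) : Finset I :=
  (C.1.toMultiset.map v).toFinset

theorem PrimeCycle.length_pos (C : X.PrimeCycle) : 0 < C.length := by
  obtain ⟨C, c, rfl, ⟨-, hc, -⟩, -⟩ := C
  simpa [PrimeCycle.length] using List.length_pos_iff.2 hc

theorem PrimeCycle.weight_ite [DecidableEq I] (v : X.Arc → I) (C : X.PrimeCycle) (S : Finset I)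
    (t : ℝ) :
    C.weight (fun a => if v a ∈ S then (t : ℂ) else 0) =
      ((if C.labels v ⊆ S then t ^ C.length else 0 : ℝ) : ℂ) := by
  unfold PrimeCycle.weight
  split_ifs with h
  · have : C.1.toMultiset.map (fun a => if v a ∈ S then (t : ℂ) else 0) =
        C.1.toMultiset.map fun _ => (t : ℂ) := by
      refine Multiset.map_congr rfl fun a ha => if_pos (h ?_)
      simp only [PrimeCycle.labels, Multiset.mem_toFinset, Multiset.mem_map]
      exact ⟨a, ha, rfl⟩
    rw [this]
    simp [PrimeCycle.length]
  · rw [Finset.not_subset] at h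
    obtain ⟨i, hi, hiS⟩ := h
    simp only [PrimeCycle.labels, Multiset.mem_toFinset, Multiset.mem_map] at hi
    obtain ⟨a, ha, rfl⟩ := hi
    simp only [Complex.ofReal_zero]
    exact Multiset.prod_eq_zero (Multiset.mem_map.2 ⟨a, ha, if_neg hiS⟩)

/-- The contribution of a prime cycle to `log ζ` at the point with all coordinates equal to `t`. -/
def PrimeCycle.logTerm (t : ℝ) (C : X.PrimeCycle) : ℝ := -Real.log (1 - t ^ C.length)

theorem PrimeCycle.pow_length_le {t : ℝ} (h0 : 0 < t) (h1 : t ≤ 1 / 2) (C : X.PrimeCycle) :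
    t ^ C.length ≤ 1 / 2 :=
  (pow_le_of_le_one h0.le (by linarith) C.length_pos.ne').trans h1

theorem PrimeCycle.logTerm_pos {t : ℝ} (h0 : 0 < t) (h1 : t ≤ 1 / 2) (C : X.PrimeCycle) :
    0 < C.logTerm t := by
  have h2 := C.pow_length_le h0 h1
  have h3 : 0 < t ^ C.length := by positivity
  exact neg_pos.2 (Real.log_neg (by linarith) (by linarith))

/-- Choosing a representative embeds the prime cycles into the words in the arcs, and the
logarithmic term is at most twice `t ^ length`. -/
theorem summable_logTerm [Fintype X.Arc] {t : ℝ} (h0 : 0 < t) (h1 : t ≤ 1 / 2)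
    (h2 : Fintype.card X.Arc * t < 1) :
    Summable fun C : X.PrimeCycle => C.logTerm t := by
  have hinj : Function.Injective fun C : X.PrimeCycle => Quot.out C.1 := by
    intro C D h
    refine Subtype.ext ?_
    rw [← Quot.out_eq C.1, ← Quot.out_eq D.1]
    exact congrArg _ h
  have hs := ((summable_pow_length h0.le h2).comp_injective hinj).mul_left 2
  refine hs.of_nonneg_of_le (fun C => (C.logTerm_pos h0 h1).le) fun C => ?_
  have hl : (Quot.out C.1).length = C.length := by
    conv_rhs => rw [PrimeCycle.length, ← Quot.out_eq C.1]
    rfl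
  simp only [Function.comp, hl]
  exact neg_log_one_sub_le (by positivity) (C.pow_length_le h0 h1)

variable [DecidableEq I]

theorem summable_ite_logTerm [Fintype X.Arc] {t : ℝ} (h0 : 0 < t) (h1 : t ≤ 1 / 2)
    (h2 : Fintype.card X.Arc * t < 1) (p : X.PrimeCycle → Prop) [DecidablePred p] :
    Summable fun C : X.PrimeCycle => if p C then C.logTerm t else 0 := by
  refine (summable_logTerm h0 h1 h2).of_nonneg_of_le (fun C => ?_) fun C => ?_ <;>
    have := C.logTerm_pos h0 h1 <;> split_ifs <;> linarith

/-- A prime with a label outside `S` has weight `0` and hence Euler factor `1`; the other factors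
are real exponentials of `logTerm`. -/
theorem edgeZeta_ite [Fintype X.Arc] (v : X.Arc → I) (S : Finset I)
    {t : ℝ} (h0 : 0 < t) (h1 : t ≤ 1 / 2) (h2 : Fintype.card X.Arc * t < 1) :
    X.edgeZeta (fun a => if v a ∈ S then (t : ℂ) else 0) =
      ((Real.exp (∑' C : X.PrimeCycle, if C.labels v ⊆ S then C.logTerm t else 0) : ℝ) : ℂ) := by
  have hs := summable_ite_logTerm h0 h1 h2 fun C : X.PrimeCycle => C.labels v ⊆ S
  have hp := (Complex.hasSum_ofReal.2 hs.hasSum).cexp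
  rw [Complex.ofReal_exp, ← hp.tprod_eq]
  refine tprod_congr fun C => ?_
  rw [PrimeCycle.weight_ite]
  have h3 := C.pow_length_le h0 h1
  simp only [Function.comp]
  split_ifs
  · rw [← Complex.ofReal_exp, PrimeCycle.logTerm, Real.exp_neg, Real.exp_log (by linarith)]
    push_cast
    rfl
  · simp

/-- The part of `log ζ` coming from the prime cycles with a given set of labels. -/
def logZetaPart (X : Graph α β) (v : X.Arc → I) (t : ℝ) (T : Finset I) : ℝ :=
  ∑' C : X.PrimeCycle, if C.labels v = T then C.logTerm t else 0

theorem sum_logZetaPart [Fintype X.Arc] (v : X.Arc → I) (S : Finset I)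
    {t : ℝ} (h0 : 0 < t) (h1 : t ≤ 1 / 2) (h2 : Fintype.card X.Arc * t < 1) :
    ∑ T ∈ S.powerset, X.logZetaPart v t T =
      ∑' C : X.PrimeCycle, if C.labels v ⊆ S then C.logTerm t else 0 := by
  unfold logZetaPart
  rw [← Summable.tsum_finsetSum fun T _ => summable_ite_logTerm h0 h1 h2 _]
  refine tsum_congr fun C => ?_
  rw [Finset.sum_ite_eq]
  simp

/-- `T` is the set of labels of a prime cycle. -/
def IsPrimeSupport (X : Graph α β) (v : X.Arc → I) (T : Finset I) : Prop :=
  ∃ c : List X.Arc, X.IsPrimeArcCycle c ∧ ∀ i, i ∈ T ↔ ∃ a ∈ c, v a = i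

/-- The terms of primes with label set `T` are strictly positive, so nothing cancels. -/
theorem isPrimeSupport_iff_pos [Fintype X.Arc] (v : X.Arc → I) (T : Finset I)
    {t : ℝ} (h0 : 0 < t) (h1 : t ≤ 1 / 2) (h2 : Fintype.card X.Arc * t < 1) :
    X.IsPrimeSupport v T ↔ 0 < X.logZetaPart v t T := by
  have hnn : ∀ C : X.PrimeCycle, 0 ≤ if C.labels v = T then C.logTerm t else 0 := by
    intro C
    have := C.logTerm_pos h0 h1
    split_ifs <;> linarith
  constructor
  · rintro ⟨c, hc, hT⟩
    refine (summable_ite_logTerm h0 h1 h2 _).tsum_pos hnn ⟨c, c, rfl, hc⟩ ?_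
    rw [if_pos]
    · exact PrimeCycle.logTerm_pos h0 h1 _
    · ext i
      simp [PrimeCycle.labels, hT]
  · intro hpos
    by_contra hno
    refine hpos.ne' ?_
    unfold logZetaPart
    refine (tsum_congr fun C => if_neg ?_).trans tsum_zero
    rintro rfl
    obtain ⟨C, c, rfl, hc⟩ := C
    exact hno ⟨c, hc, fun i => by simp [PrimeCycle.labels]⟩

end Zeta

/-- The hypotheses on two graphs with a common set of labels for their arcs and with the same edge
zeta function. -/
structure SameZeta {α β α' β' I : Type*} (X : Graph α β) (Y : Graph α' β') (inv : I → I)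
    (v : X.Arc → I) (w : Y.Arc → I) : Prop where
  finite_left : X.edgeSet.Finite
  finite_right : Y.edgeSet.Finite
  inj_left : Function.Injective v
  inj_right : Function.Injective w
  inv_left : ∀ a : X.Arc, v a.inv = inv (v a)
  inv_right : ∀ a : Y.Arc, w a.inv = inv (w a)
  zeta : ∀ᶠ u in nhds (0 : I → ℂ),
      X.edgeZeta (fun a => u (v a)) = Y.edgeZeta (fun a => u (w a))

/-! ### Recovering the label sets of primes from the zeta function. -/

section SameZeta

variable {α β α' β' I : Type*} {X : Graph α β} {Y : Graph α' β'} {inv : I → I}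
  {v : X.Arc → I} {w : Y.Arc → I}

theorem SameZeta.symm (h : SameZeta X Y inv v w) : SameZeta Y X inv w v :=
  ⟨h.2, h.1, h.4, h.3, h.6, h.5, h.7.mono fun _ hu => hu.symm⟩

/-- Graphs with the same edge zeta function have prime cycles with the same sets of labels. -/
theorem SameZeta.isPrimeSupport_iff [Finite I] [DecidableEq I] (h : SameZeta X Y inv v w)
    (T : Finset I) : X.IsPrimeSupport v T ↔ Y.IsPrimeSupport w T := by
  have := finite_arc h.finite_left
  have := finite_arc h.finite_right
  have := Fintype.ofFinite X.Arc
  have := Fintype.ofFinite Y.Arc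
  have := Fintype.ofFinite I
  obtain ⟨ε, hε, hz⟩ := Metric.eventually_nhds_iff.1 h.zeta
  have hlim : ∀ r : ℝ, Tendsto (fun t : ℝ => r * t) (𝓝[>] 0) (𝓝 0) := by
    intro r
    have : Tendsto (fun t : ℝ => r * t) (𝓝 0) (𝓝 (r * 0)) := by
      apply Continuous.tendsto; fun_prop
    rw [mul_zero] at this
    exact this.mono_left nhdsWithin_le_nhds
  -- One `t` serves all label sets: `t < ε` keeps the test points where the zeta functions agree,
  -- and the other bounds give convergence and positivity for both graphs.
  obtain ⟨t, ⟨⟨⟨ht0, htε⟩, ht2⟩, htX⟩, htY⟩ :=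
    ((((eventually_mem_nhdsWithin.and ((hlim 1).eventually_lt_const hε)).and
      ((hlim 1).eventually_lt_const (show (0 : ℝ) < 1 / 2 by norm_num))).and
      ((hlim (Fintype.card X.Arc)).eventually_lt_const one_pos)).and
      ((hlim (Fintype.card Y.Arc)).eventually_lt_const one_pos)).exists
  simp only [one_mul, Set.mem_Ioi] at ht0 htε ht2
  have hsum : ∀ S : Finset I, ∑ T ∈ S.powerset, X.logZetaPart v t T =
      ∑ T ∈ S.powerset, Y.logZetaPart w t T := by
    intro S
    obtain ⟨u, hu⟩ : ∃ u : I → ℂ, u = fun i => if i ∈ S then (t : ℂ) else 0 := ⟨_, rfl⟩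
    have hd : dist u 0 < ε := by
      rw [dist_pi_lt_iff hε]
      intro i
      simp only [hu, Pi.zero_apply, dist_zero_right]
      split_ifs
      · simpa [abs_of_pos ht0] using htε
      · simpa using hε
    have hS := hz hd
    simp only [hu] at hS
    rw [edgeZeta_ite v S ht0 ht2.le htX, edgeZeta_ite w S ht0 ht2.le htY] at hS
    rw [sum_logZetaPart v S ht0 ht2.le htX, sum_logZetaPart w S ht0 ht2.le htY]
    exact Real.exp_injective (Complex.ofReal_injective hS)
  -- Möbius inversion on the subset lattice, as a strong induction that removes the proper subsets.
  have hpart : ∀ S : Finset I, X.logZetaPart v t S = Y.logZetaPart w t S := by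
    intro S
    induction S using Finset.strongInduction with
    | H S ih =>
      have := hsum S
      rw [← Finset.add_sum_erase _ _ (Finset.mem_powerset_self S),
        ← Finset.add_sum_erase _ _ (Finset.mem_powerset_self S)] at this
      rw [Finset.sum_congr rfl fun T hT => ih T ?_] at this
      · exact add_right_cancel this
      · rw [Finset.mem_erase, Finset.mem_powerset] at hT
        exact hT.2.ssubset_of_ne hT.1
  rw [isPrimeSupport_iff_pos v T ht0 ht2.le htX, isPrimeSupport_iff_pos w T ht0 ht2.le htY, hpart]

end SameZeta

/-! ### Undirected and directed triangles. -/

section Triangle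

variable {α β : Type*} {X : Graph α β}

theorem IsArcCycle.exists_next {d : List X.Arc} (hd : X.IsArcCycle d) {a : X.Arc} (ha : a ∈ d) :
    ∃ b ∈ d, a.terminus = b.origin := by
  obtain ⟨i, hi, rfl⟩ := List.getElem_of_mem ha
  obtain ⟨hc, h0, h1⟩ := hd
  by_cases h : i + 1 < d.length
  · exact ⟨_, List.getElem_mem h, List.isChain_iff_getElem.1 hc i h⟩
  · refine ⟨_, List.head_mem h0, ?_⟩
    rw [← h1, List.getLast_eq_getElem]
    congr 2; omega

/-- The edges `e`, `f`, `g` are the sides of a triangle. -/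
def IsTriangle (X : Graph α β) (e f g : β) : Prop :=
  ∃ x y z, x ≠ y ∧ y ≠ z ∧ z ≠ x ∧ X.IsLink e x y ∧ X.IsLink f y z ∧ X.IsLink g z x

theorem IsTriangle.rotate {e f g : β} (h : X.IsTriangle e f g) : X.IsTriangle f g e := by
  obtain ⟨x, y, z, h1, h2, h3, h4, h5, h6⟩ := h
  exact ⟨y, z, x, h2, h3, h1, h5, h6, h4⟩

theorem IsTriangle.swap {e f g : β} (h : X.IsTriangle e f g) : X.IsTriangle e g f := by
  obtain ⟨x, y, z, h1, h2, h3, h4, h5, h6⟩ := h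
  exact ⟨y, x, z, h1.symm, h3.symm, h2.symm, h4.symm, h6.symm, h5.symm⟩

/-- This separates triangles from stars; it excludes the exceptional configuration in the transfer
of complete graphs. -/
theorem IsTriangle.not_inc {e f g : β} (h : X.IsTriangle e f g) {x : α} (he : X.Inc e x)
    (hf : X.Inc f x) (hg : X.Inc g x) : False := by
  obtain ⟨a, b, c, h1, h2, h3, h4, h5, h6⟩ := h
  have := he.eq_or_eq_of_isLink h4
  have := hf.eq_or_eq_of_isLink h5
  have := hg.eq_or_eq_of_isLink h6
  grind

/-- The arcs `a`, `b`, `c` form a directed triangle. -/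
structure IsArcTriangle (a b c : X.Arc) : Prop where
  link_ab : a.terminus = b.origin
  link_bc : b.terminus = c.origin
  link_ca : c.terminus = a.origin
  ne_ab : a.origin ≠ b.origin
  ne_bc : b.origin ≠ c.origin
  ne_ca : c.origin ≠ a.origin

namespace IsArcTriangle

variable {a b c : X.Arc}

theorem isTriangle (h : IsArcTriangle a b c) : X.IsTriangle a.edge b.edge c.edge :=
  ⟨_, _, _, h.ne_ab, h.ne_bc, h.ne_ca, h.link_ab ▸ a.isLink, h.link_bc ▸ b.isLink,
    h.link_ca ▸ c.isLink⟩

theorem isArcCycle (h : IsArcTriangle a b c) : X.IsArcCycle [a, b, c] :=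
  ⟨by simp [h.link_ab, h.link_bc], by simp, by simp [h.link_ca]⟩

theorem nodup (h : IsArcTriangle a b c) : [a, b, c].Nodup := by
  have h1 := h.ne_ab
  have h2 := h.ne_bc
  have h3 := h.ne_ca
  simp only [List.nodup_cons, List.mem_cons, List.not_mem_nil, or_false, not_or, not_false_eq_true,
    List.nodup_nil, and_true]
  refine ⟨⟨?_, ?_⟩, ?_⟩ <;> rintro rfl <;> contradiction

theorem inv_notMem (h : IsArcTriangle a b c) : ∀ x ∈ [a, b, c], x.inv ∉ [a, b, c] := by
  obtain ⟨h1, h2, h3, h4, h5, h6⟩ := h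
  intro x hx hy
  obtain ⟨y, hxy⟩ : ∃ y, x.inv = y := ⟨_, rfl⟩
  have ho : y.origin = x.terminus := by rw [← hxy, Arc.origin_inv]
  have ht : y.terminus = x.origin := by rw [← hxy, Arc.terminus_inv]
  rw [hxy] at hy
  simp only [List.mem_cons, List.not_mem_nil, or_false] at hx hy
  rcases hx with rfl | rfl | rfl <;> rcases hy with rfl | rfl | rfl <;> grind

/-- The origins of the three arcs are distinct, so within the triangle each arc has a unique
possible successor. -/
theorem mem_of_isArcCycle (h : IsArcTriangle a b c) {d : List X.Arc} (hd : X.IsArcCycle d)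
    (hsub : d ⊆ [a, b, c]) : a ∈ d ∧ b ∈ d ∧ c ∈ d := by
  obtain ⟨h1, h2, h3, h4, h5, h6⟩ := h
  have hab : a ∈ d → b ∈ d := by
    intro ha
    obtain ⟨y, hy, hya⟩ := hd.exists_next ha
    have := hsub hy
    simp only [List.mem_cons, List.not_mem_nil, or_false] at this
    grind
  have hbc : b ∈ d → c ∈ d := by
    intro ha
    obtain ⟨y, hy, hya⟩ := hd.exists_next ha
    have := hsub hy
    simp only [List.mem_cons, List.not_mem_nil, or_false] at this
    grind
  have hca : c ∈ d → a ∈ d := by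
    intro ha
    obtain ⟨y, hy, hya⟩ := hd.exists_next ha
    have := hsub hy
    simp only [List.mem_cons, List.not_mem_nil, or_false] at this
    grind
  obtain ⟨x, hx⟩ := List.exists_mem_of_ne_nil d hd.2.1
  have := hsub hx
  simp only [List.mem_cons, List.not_mem_nil, or_false] at this
  grind

end IsArcTriangle

theorem exists_isArcTriangle {e f g : β} {x y z : α} (hxy : x ≠ y) (hyz : y ≠ z) (hzx : z ≠ x)
    (he : X.IsLink e x y) (hf : X.IsLink f y z) (hg : X.IsLink g z x) :
    ∃ a b c : X.Arc, IsArcTriangle a b c ∧ (a.edge : β) = e ∧ (b.edge : β) = f ∧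
      (c.edge : β) = g ∧ a.origin = x := by
  obtain ⟨a, rfl, rfl, rfl⟩ := he.exists_arc
  obtain ⟨b, rfl, hb, rfl⟩ := hf.exists_arc
  obtain ⟨c, rfl, hc, hc'⟩ := hg.exists_arc
  exact ⟨a, b, c, ⟨hb.symm, hc.symm, hc', by rwa [hb], by rwa [hb, hc], by rwa [hc]⟩,
    rfl, rfl, rfl, rfl⟩

end Triangle

/-! ### Transfer of edges, triangles and loops between the two graphs. -/

section Transfer

variable {α β α' β' I : Type*} {X : Graph α β} {Y : Graph α' β'} {inv : I → I}
  {v : X.Arc → I} {w : Y.Arc → I}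

/-- Two edges of the two graphs correspond to each other if they have arcs with the same label. -/
def SameLabel (v : X.Arc → I) (w : Y.Arc → I) (e : β) (e' : β') : Prop :=
  ∃ (a : X.Arc) (b : Y.Arc), (a.edge : β) = e ∧ (b.edge : β') = e' ∧ w b = v a

theorem SameLabel.symm {e : β} {e' : β'} (h : SameLabel v w e e') : SameLabel w v e' e := by
  obtain ⟨a, b, h1, h2, h3⟩ := h
  exact ⟨b, a, h2, h1, h3.symm⟩

/-- Both graphs use the same involution-like map `inv` on labels of inverse arcs, so matching an
edge through either of its arcs gives the same partner. -/
theorem SameZeta.right_unique (h : SameZeta X Y inv v w) {e : β} {e' f' : β'}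
    (he : SameLabel v w e e') (hf : SameLabel v w e f') : e' = f' := by
  obtain ⟨a, b, rfl, rfl, hab⟩ := he
  obtain ⟨c, d, hc, rfl, hcd⟩ := hf
  rcases Arc.eq_or_eq_inv (Subtype.ext hc) with rfl | rfl
  · rw [h.inj_right (hcd.trans hab.symm)]
  · rw [h.inv_left, ← hab, ← h.inv_right] at hcd
    rw [h.inj_right hcd, Arc.edge_inv]

theorem SameZeta.exists_arcTriangle [Finite I] (h : SameZeta X Y inv v w) {a b c : X.Arc}
    (habc : IsArcTriangle a b c) :
    ∃ a' b' c' : Y.Arc, w a' = v a ∧ w b' = v b ∧ w c' = v c ∧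
      Y.IsTriangle a'.edge b'.edge c'.edge := by
  classical
  obtain ⟨d, hd, hdT⟩ := (h.isPrimeSupport_iff {v a, v b, v c}).1
    ⟨[a, b, c], isPrimeArcCycle_of_nodup habc.isArcCycle habc.nodup habc.inv_notMem, fun i => by
      simp [eq_comm]⟩
  -- The prime `d` may repeat arcs, so it is replaced by a vertex-simple cycle `s`, which might a
  -- priori use only some of the three labels.
  obtain ⟨s, hs, hsd, hsn⟩ := hd.1.exists_nodup_origin
  have hsnd : s.Nodup := hsn.of_map
  have hlab : ∀ p ∈ s, ∃ x ∈ [a, b, c], v x = w p := by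
    intro p hp
    have := (hdT (w p)).2 ⟨p, hsd hp, rfl⟩
    simpa [eq_comm] using this
  have hsp : Y.IsPrimeArcCycle s := by
    refine isPrimeArcCycle_of_nodup hs hsnd fun p hp hp' => ?_
    obtain ⟨x, hx, hxp⟩ := hlab p hp
    obtain ⟨y, hy, hyp⟩ := hlab _ hp'
    rw [h.inv_right, ← hxp, ← h.inv_left] at hyp
    exact habc.inv_notMem x hx (h.inj_left hyp ▸ hy)
  -- Going back to `X` shows that no label was lost: a cycle inside the triangle contains `a`, `b`
  -- and `c`.
  obtain ⟨d', hd', hdT'⟩ := (h.isPrimeSupport_iff (s.map w).toFinset).2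
    ⟨s, hsp, fun i => by simp⟩
  have hmem : ∀ x ∈ d', ∃ p ∈ s, w p = v x := by
    intro x hx
    have := (hdT' (v x)).2 ⟨x, hx, rfl⟩
    simpa using this
  obtain ⟨ha, hb, hc⟩ := habc.mem_of_isArcCycle hd'.1 fun x hx => by
    obtain ⟨p, hp, hpx⟩ := hmem x hx
    obtain ⟨y, hy, hyp⟩ := hlab p hp
    exact h.inj_left (hyp.trans hpx) ▸ hy
  obtain ⟨a', ha's, ha'⟩ := hmem a ha
  obtain ⟨b', hb's, hb'⟩ := hmem b hb
  obtain ⟨c', hc's, hc'⟩ := hmem c hc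
  have hnd' : [a', b', c'].Nodup := by
    have := habc.nodup.map h.inj_left
    refine List.Nodup.of_map w ?_
    simpa [ha', hb', hc'] using this
  have hperm : List.Perm [a', b', c'] s := by
    rw [List.perm_ext_iff_of_nodup hnd' hsnd]
    intro p
    constructor
    · simp only [List.mem_cons, List.not_mem_nil, or_false]
      rintro (rfl | rfl | rfl) <;> assumption
    · intro hp
      obtain ⟨x, hx, hxp⟩ := hlab p hp
      simp only [List.mem_cons, List.not_mem_nil, or_false] at hx ⊢
      rcases hx with rfl | rfl | rfl
      · exact Or.inl (h.inj_right (hxp.symm.trans ha'.symm))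
      · exact Or.inr (Or.inl (h.inj_right (hxp.symm.trans hb'.symm)))
      · exact Or.inr (Or.inr (h.inj_right (hxp.symm.trans hc'.symm)))
  obtain ⟨p, q, r, rfl⟩ := List.length_eq_three.1 (hperm.length_eq.symm.trans rfl)
  refine ⟨a', b', c', ha', hb', hc', ?_⟩
  have htri : Y.IsTriangle p.edge q.edge r.edge := by
    obtain ⟨h1, h2, h3⟩ := hs
    simp only [List.isChain_cons_cons, List.isChain_singleton, and_true, List.map_cons,
      List.map_nil, List.nodup_cons, List.mem_cons, List.not_mem_nil, or_false, not_or] at h1 hsn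
    exact IsArcTriangle.isTriangle ⟨h1.1, h1.2, by simpa using h3, hsn.1.1, hsn.2.1,
      Ne.symm hsn.1.2⟩
  simp only [List.mem_cons, List.not_mem_nil, or_false, List.nodup_cons, not_or] at ha's hb's hc's hnd'
  -- The order of the three arcs along `s` is unknown; all six orders give the same undirected
  -- triangle.
  rcases ha's with rfl | rfl | rfl <;> rcases hb's with rfl | rfl | rfl <;>
    rcases hc's with rfl | rfl | rfl <;>
    first
    | exact absurd rfl hnd'.1.1
    | exact absurd rfl hnd'.1.2
    | exact absurd rfl hnd'.2.1
    | exact htri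
    | exact htri.swap
    | exact htri.rotate
    | exact htri.rotate.rotate
    | exact htri.rotate.swap
    | exact htri.rotate.rotate.swap

/-- Graphs with the same edge zeta function have the same triangles. -/
theorem SameZeta.exists_triangle [Finite I] (h : SameZeta X Y inv v w) {e f g : β}
    (hefg : X.IsTriangle e f g) :
    ∃ e' f' g' : β', SameLabel v w e e' ∧ SameLabel v w f f' ∧ SameLabel v w g g' ∧
      Y.IsTriangle e' f' g' := by
  obtain ⟨x, y, z, hxy, hyz, hzx, he, hf, hg⟩ := hefg
  obtain ⟨a, b, c, habc, rfl, rfl, rfl, -⟩ := exists_isArcTriangle hxy hyz hzx he hf hg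
  obtain ⟨a', b', c', ha, hb, hc, ht⟩ := h.exists_arcTriangle habc
  exact ⟨_, _, _, ⟨a, a', rfl, rfl, ha⟩, ⟨b, b', rfl, rfl, hb⟩, ⟨c, c', rfl, rfl, hc⟩, ht⟩

theorem SameZeta.isTriangle [Finite I] (h : SameZeta X Y inv v w) {e f g : β} {e' f' g' : β'}
    (hefg : X.IsTriangle e f g) (he : SameLabel v w e e') (hf : SameLabel v w f f')
    (hg : SameLabel v w g g') : Y.IsTriangle e' f' g' := by
  obtain ⟨e₁, f₁, g₁, he₁, hf₁, hg₁, ht⟩ := h.exists_triangle hefg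
  rwa [h.right_unique he he₁, h.right_unique hf hf₁, h.right_unique hg hg₁]

/-- A loop at a vertex of a triangle corresponds to a loop at a vertex of the corresponding
triangle. -/
theorem SameZeta.exists_loop [Finite I] (h : SameZeta X Y inv v w) {e f g l : β} {x y z : α}
    (hxy : x ≠ y) (hyz : y ≠ z) (hzx : z ≠ x)
    (he : X.IsLink e x y) (hf : X.IsLink f y z) (hg : X.IsLink g z x) (hl : X.IsLink l x x)
    {e' f' g' : β'} (hee : SameLabel v w e e') (hff : SameLabel v w f f')
    (hgg : SameLabel v w g g') :
    ∃ l' t, SameLabel v w l l' ∧ Y.IsLink l' t t ∧ (Y.Inc e' t ∨ Y.Inc f' t ∨ Y.Inc g' t) := by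
  classical
  obtain ⟨a, b, c, habc, rfl, rfl, rfl, rfl⟩ := exists_isArcTriangle hxy hyz hzx he hf hg
  obtain ⟨k, rfl, hk, hk'⟩ := hl.exists_arc
  have hsub : ∀ {p : Y.Arc} {q : X.Arc} {s : β'}, w p = v q → SameLabel v w q.edge s →
      (p.edge : β') = s := fun hp hs => h.right_unique ⟨_, _, rfl, rfl, hp⟩ hs
  obtain ⟨d, hd, hdT⟩ := (h.isPrimeSupport_iff {v k}).1
    ⟨[k], isPrimeArcCycle_of_nodup ⟨by simp, by simp, by simp [hk, hk']⟩ (by simp)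
      (by simp [Arc.inv_ne]), fun i => by simp [eq_comm]⟩
  obtain ⟨k', hk'd, hk'v⟩ := (hdT (v k)).1 (by simp)
  -- The arc following `k'` carries the same label, so it is `k'` itself.
  have hloop : k'.terminus = k'.origin := by
    obtain ⟨m, hm, hmk⟩ := hd.1.exists_next hk'd
    have : w m = v k := by simpa using (hdT (w m)).2 ⟨m, hm, rfl⟩
    rwa [h.inj_right (this.trans hk'v.symm)] at hmk
  have hka : k ≠ a := by
    rintro rfl; exact habc.ne_ab (hk'.symm.trans habc.link_ab)
  have hkb : k ≠ b := by
    rintro rfl; exact habc.ne_ab hk.symm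
  have hkc : k ≠ c := by
    rintro rfl; exact habc.ne_ca hk
  have hki : ∀ m ∈ [a, b, c], k.inv ≠ m := by
    intro m hm h0
    have h1 : m.origin = m.terminus := by
      rw [← h0, Arc.origin_inv, Arc.terminus_inv, hk, hk']
    obtain ⟨g1, g2, g3, g4, g5, g6⟩ := habc
    simp only [List.mem_cons, List.not_mem_nil, or_false] at hm
    rcases hm with rfl | rfl | rfl <;> grind
  -- The loop followed by the triangle is a prime whose counterpart must connect the corresponding
  -- arcs in `Y`.
  obtain ⟨d₂, hd₂, hdT₂⟩ := (h.isPrimeSupport_iff {v k, v a, v b, v c}).1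
    ⟨[k, a, b, c], isPrimeArcCycle_of_nodup
      ⟨by simp [hk', habc.link_ab, habc.link_bc], by simp, by simp [hk, habc.link_ca]⟩
      (List.nodup_cons.2 ⟨by simp [hka, hkb, hkc], habc.nodup⟩)
      (by
        intro m hm hm'
        rcases List.mem_cons.1 hm with rfl | hm <;> rcases List.mem_cons.1 hm' with hm' | hm'
        · exact Arc.inv_ne _ hm'
        · exact hki _ hm' rfl
        · exact hki m hm (by rw [← hm', Arc.inv_inv])
        · exact habc.inv_notMem m hm hm'), fun i => by simp [eq_comm]⟩
  refine ⟨k'.edge, k'.origin, ⟨k, k', rfl, rfl, hk'v⟩, by simpa [hloop] using k'.isLink, ?_⟩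
  by_contra hno
  push Not at hno
  have hoff : ∀ m ∈ d₂, m = k' ∨ (m.origin ≠ k'.origin ∧ m.terminus ≠ k'.origin) := by
    intro m hm
    have := (hdT₂ (w m)).2 ⟨m, hm, rfl⟩
    simp only [Finset.mem_insert, Finset.mem_singleton] at this
    have hends : ¬ Y.Inc m.edge k'.origin → m.origin ≠ k'.origin ∧ m.terminus ≠ k'.origin :=
      fun hn => ⟨fun h0 => hn (h0 ▸ m.isLink.inc_left), fun h0 => hn (h0 ▸ m.isLink.inc_right)⟩
    rcases this with hm | hm | hm | hm
    · exact Or.inl (h.inj_right (hm.trans hk'v.symm))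
    · exact Or.inr (hends (hsub hm hee ▸ hno.1))
    · exact Or.inr (hends (hsub hm hff ▸ hno.2.1))
    · exact Or.inr (hends (hsub hm hgg ▸ hno.2.2))
  obtain ⟨m, hm, hmk⟩ := (hdT₂ (v k)).1 (by simp)
  obtain ⟨n, hn, hna⟩ := (hdT₂ (v a)).1 (by simp)
  -- If the loop were off the triangle, no arc of `d₂` would enter or leave its vertex, yet `d₂`
  -- contains both the loop and the arc labelled `v a`.
  have h1 := origin_mem_iff_of_isChain hd₂.1.1 (fun s => s = k'.origin) (by
    intro p hp
    rcases hoff p hp with rfl | ⟨h1, h2⟩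
    · simp [hloop]
    · simp [h1, h2]) m hm n hn
  rw [h.inj_right (hmk.trans hk'v.symm)] at h1
  rcases hoff n hn with rfl | ⟨h2, -⟩
  · exact hka (h.inj_left (hk'v.symm.trans hna))
  · exact h2 (h1.1 rfl)

end Transfer

/-! ### Complete subgraphs and their description by edge sets. -/

section Complete

variable {α β : Type*} {X : Graph α β} {r : ℕ}

/-- The vertices `p i` and the edges `q s(i, j)`, `i ≠ j`, form a complete graph. -/
structure IsCompleteSub (X : Graph α β) (p : Fin r → α) (q : Sym2 (Fin r) → β) : Prop where
  inj : Function.Injective p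
  link : ∀ i j, i ≠ j → X.IsLink (q s(i, j)) (p i) (p j)

/-- The edges of a complete subgraph. -/
def completeEdges (q : Sym2 (Fin r) → β) : Set β := q '' {s | ¬ s.IsDiag}

/-- There are no edges between the vertices of the complete subgraph other than those in it. -/
def IsFull (X : Graph α β) (p : Fin r → α) (q : Sym2 (Fin r) → β) : Prop :=
  ∀ e i j, X.IsLink e (p i) (p j) → e ∈ completeEdges q

theorem mem_completeEdges {q : Sym2 (Fin r) → β} {e : β} :
    e ∈ completeEdges q ↔ ∃ i j, i ≠ j ∧ q s(i, j) = e := by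
  constructor
  · rintro ⟨s, hs, rfl⟩
    induction s with
    | h i j => exact ⟨i, j, by simpa using hs, rfl⟩
  · rintro ⟨i, j, hij, rfl⟩
    exact ⟨s(i, j), by simpa using hij, rfl⟩

theorem exists_ne_ne (hr : 3 ≤ r) (i j : Fin r) : ∃ k, k ≠ i ∧ k ≠ j := by
  have : ({i, j} : Finset (Fin r)).card < Fintype.card (Fin r) := by
    have := Finset.card_le_two (a := i) (b := j)
    simp only [Fintype.card_fin]; omega
  obtain ⟨k, hk⟩ := Finset.exists_mem_notMem_of_card_lt_card (s := {i, j}) (t := Finset.univ)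
    (by simpa using this)
  exact ⟨k, by simpa using hk.2⟩

theorem IsCompleteSub.isTriangle {p : Fin r → α} {q : Sym2 (Fin r) → β}
    (h : X.IsCompleteSub p q) {i j k : Fin r} (hij : i ≠ j) (hjk : j ≠ k) (hki : k ≠ i) :
    X.IsTriangle (q s(i, j)) (q s(j, k)) (q s(k, i)) :=
  ⟨_, _, _, h.inj.ne hij, h.inj.ne hjk, h.inj.ne hki, h.link i j hij, h.link j k hjk,
    h.link k i hki⟩

theorem completeEdges_subset {p : Fin r → α} {q : Sym2 (Fin r) → β}
    (h : X.IsCompleteSub p q) : completeEdges q ⊆ X.edgeSet := by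
  intro e he
  obtain ⟨i, j, hij, rfl⟩ := mem_completeEdges.1 he
  exact (h.link i j hij).edge_mem

theorem complete_isLink {e : Sym2 (Fin r)} {i j : Fin r} :
    (complete r).IsLink e i j ↔ e = s(i, j) ∧ i ≠ j := by
  unfold complete
  simp only [ofSimpleGraph_isLink]
  constructor
  · rintro ⟨rfl, h⟩
    exact ⟨rfl, by simpa using h⟩
  · rintro ⟨rfl, h⟩
    exact ⟨rfl, by simpa using h⟩

theorem simple_of_isLink {G : Graph α β} (hl : ∀ e x, ¬ G.IsLink e x x)
    (hp : ∀ e f x y, G.IsLink e x y → G.IsLink f x y → e = f) : G.Simple :=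
  { not_isLoopAt := hl, eq_of_isLink := hp }

/-- Simplicity makes an edge determined by its ends, so the edge bijection can be rebuilt from an
enumeration of the vertices. -/
theorem nonempty_iso_complete_iff {G : Graph α β} :
    Nonempty (Iso G (complete r)) ↔ G.Simple ∧ ∃ p : Fin r → α,
      Function.Injective p ∧ Set.range p = G.vertexSet ∧ ∀ i j, i ≠ j → G.Adj (p i) (p j) := by
  have hV : ∀ i : Fin r, i ∈ (complete r).vertexSet := fun i => by simp [complete]
  constructor
  · rintro ⟨φ⟩
    refine ⟨simple_of_isLink (fun e x h => ?_) fun e f x y he hf => ?_,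
      fun i => φ.vertexEquiv.symm ⟨i, hV i⟩, fun i j hij => ?_, ?_, fun i j hij => ?_⟩
    · have h1 := (φ.isLink_iff ⟨e, h.edge_mem⟩ ⟨x, h.left_mem⟩ ⟨x, h.left_mem⟩).2 h
      exact (complete_isLink.1 h1).2 rfl
    · have h1 := (φ.isLink_iff ⟨e, he.edge_mem⟩ ⟨x, he.left_mem⟩ ⟨y, he.right_mem⟩).2 he
      have h2 := (φ.isLink_iff ⟨f, hf.edge_mem⟩ ⟨x, he.left_mem⟩ ⟨y, he.right_mem⟩).2 hf
      have h3 := (complete_isLink.1 h1).1.trans (complete_isLink.1 h2).1.symm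
      exact congrArg Subtype.val (φ.edgeEquiv.injective (Subtype.ext h3))
    · exact congrArg Subtype.val (φ.vertexEquiv.symm.injective (Subtype.ext hij))
    · ext x
      constructor
      · rintro ⟨i, rfl⟩
        exact Subtype.coe_prop _
      · intro hx
        exact ⟨φ.vertexEquiv ⟨x, hx⟩, by simp⟩
    · have h1 : (complete r).IsLink s(i, j) i j := complete_isLink.2 ⟨rfl, hij⟩
      refine ⟨φ.edgeEquiv.symm ⟨s(i, j), h1.edge_mem⟩, ?_⟩
      rw [← φ.isLink_iff]
      simpa using h1
  · rintro ⟨hG, p, hp, hpV, hadj⟩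
    have hf : ∀ s : (complete r).edgeSet, ∃ e : G.edgeSet, ∀ i j, s.1 = s(i, j) →
        G.IsLink e (p i) (p j) := by
      rintro ⟨s, hs⟩
      obtain ⟨i, j, hij⟩ := (complete r).exists_isLink_of_mem_edgeSet hs
      obtain ⟨rfl, hne⟩ := complete_isLink.1 hij
      obtain ⟨e, he⟩ := hadj i j hne
      refine ⟨⟨e, he.edge_mem⟩, fun k l hkl => ?_⟩
      rcases Sym2.eq_iff.1 hkl with ⟨rfl, rfl⟩ | ⟨rfl, rfl⟩
      · exact he
      · exact he.symm
    choose f hf using hf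
    have hfinj : Function.Injective f := by
      rintro ⟨s, hs⟩ ⟨t, ht⟩ hst
      refine Subtype.ext ?_
      obtain ⟨i, j, hij⟩ := (complete r).exists_isLink_of_mem_edgeSet hs
      obtain ⟨rfl, -⟩ := complete_isLink.1 hij
      obtain ⟨k, l, hkl⟩ := (complete r).exists_isLink_of_mem_edgeSet ht
      obtain ⟨rfl, -⟩ := complete_isLink.1 hkl
      have h1 := hf ⟨_, hs⟩ i j rfl
      have h2 := hf ⟨_, ht⟩ k l rfl
      rw [hst] at h1
      change s(i, j) = s(k, l)
      rcases h1.eq_and_eq_or_eq_and_eq h2 with ⟨h3, h4⟩ | ⟨h3, h4⟩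
      · rw [hp h3, hp h4]
      · rw [hp h3, hp h4, Sym2.eq_swap]
    have hends : ∀ x y, x ∈ G.vertexSet → y ∈ G.vertexSet → ∃ i j, p i = x ∧ p j = y := by
      intro x y hx hy
      rw [← hpV] at hx hy
      obtain ⟨i, rfl⟩ := hx
      obtain ⟨j, rfl⟩ := hy
      exact ⟨i, j, rfl, rfl⟩
    have hfsurj : Function.Surjective f := by
      rintro ⟨e, he⟩
      obtain ⟨x, y, hxy⟩ := G.exists_isLink_of_mem_edgeSet he
      obtain ⟨i, j, rfl, rfl⟩ := hends x y hxy.left_mem hxy.right_mem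
      have hij : i ≠ j := fun h0 => hxy.ne (congrArg p h0)
      have h1 : (complete r).IsLink s(i, j) i j := complete_isLink.2 ⟨rfl, hij⟩
      exact ⟨⟨s(i, j), h1.edge_mem⟩, Subtype.ext ((hf ⟨_, h1.edge_mem⟩ i j rfl).eq hxy)⟩
    let ψ : Fin r ≃ G.vertexSet := (Equiv.ofInjective p hp).trans (Equiv.setCongr hpV)
    let ξ : Fin r ≃ (complete r).vertexSet :=
      ⟨fun i => ⟨i, hV i⟩, fun i => i.1, fun _ => rfl, fun _ => rfl⟩
    refine ⟨⟨ψ.symm.trans ξ, (Equiv.ofBijective f ⟨hfinj, hfsurj⟩).symm, fun e x y => ?_⟩⟩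
    obtain ⟨s, rfl⟩ := hfsurj e
    obtain ⟨i, rfl⟩ := ψ.surjective x
    obtain ⟨j, rfl⟩ := ψ.surjective y
    have hs : (Equiv.ofBijective f ⟨hfinj, hfsurj⟩).symm (f s) = s :=
      Equiv.ofBijective_symm_apply_apply f _ s
    rw [hs]
    simp only [Equiv.trans_apply, Equiv.symm_apply_apply]
    change (complete r).IsLink s i j ↔ G.IsLink (f s) (p i) (p j)
    rw [complete_isLink]
    constructor
    · exact fun h => hf s i j h.1
    · intro h
      have hij : i ≠ j := fun h0 => h.ne (congrArg p h0)
      refine ⟨?_, hij⟩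
      have h1 : (complete r).IsLink s(i, j) i j := complete_isLink.2 ⟨rfl, hij⟩
      have : s = ⟨s(i, j), h1.edge_mem⟩ := by
        refine hfinj (Subtype.ext (h.eq (hf ⟨_, h1.edge_mem⟩ i j rfl)))
      rw [this]

/-- The edges of complete subgraphs on `r ≥ 2` vertices. -/
theorem edgeInduce_iso_complete_iff (hr : 2 ≤ r) {R : Set β} :
    R ⊆ X.edgeSet ∧ Nonempty (Iso (X.edgeInduce R) (complete r)) ↔
      ∃ (p : Fin r → α) (q : Sym2 (Fin r) → β), X.IsCompleteSub p q ∧ R = completeEdges q := by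
  have hlink : ∀ {e : β} {x y : α}, (X.edgeInduce R).IsLink e x y ↔ e ∈ R ∧ X.IsLink e x y := by
    intro e x y
    constructor
    · exact fun h => h.1
    · rintro ⟨he, h⟩
      exact ⟨⟨he, h⟩, ⟨e, he, h.inc_left⟩, ⟨e, he, h.inc_right⟩⟩
  rw [nonempty_iso_complete_iff]
  constructor
  · rintro ⟨hR, hS, p, hp, hpV, hadj⟩
    -- `e₀` is only a default value for `q` on the diagonal.
    obtain ⟨e₀, -⟩ := hadj ⟨0, by omega⟩ ⟨1, by omega⟩ (by simp)
    have hq : ∀ s : Sym2 (Fin r), ∃ e : β, ∀ i j, s = s(i, j) → i ≠ j →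
        (X.edgeInduce R).IsLink e (p i) (p j) := by
      intro s
      induction s with
      | h i j =>
        by_cases hij : i = j
        · subst hij
          refine ⟨e₀, fun k l hkl hne => ?_⟩
          rcases Sym2.eq_iff.1 hkl with ⟨rfl, rfl⟩ | ⟨rfl, rfl⟩ <;> exact absurd rfl hne
        · obtain ⟨e, he⟩ := hadj i j hij
          refine ⟨e, fun k l hkl _ => ?_⟩
          rcases Sym2.eq_iff.1 hkl with ⟨rfl, rfl⟩ | ⟨rfl, rfl⟩
          · exact he
          · exact he.symm
    choose q hq using hq
    refine ⟨p, q, ⟨hp, fun i j hij => (hlink.1 (hq _ i j rfl hij)).2⟩, ?_⟩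
    ext e
    rw [mem_completeEdges]
    constructor
    · intro he
      obtain ⟨x, y, hxy⟩ := X.exists_isLink_of_mem_edgeSet (hR he)
      have h1 := hlink.2 ⟨he, hxy⟩
      have hx := h1.left_mem
      have hy := h1.right_mem
      rw [← hpV] at hx hy
      obtain ⟨i, rfl⟩ := hx
      obtain ⟨j, rfl⟩ := hy
      have hij : i ≠ j := fun h0 => h1.ne (congrArg p h0)
      exact ⟨i, j, hij, (hq _ i j rfl hij).eq h1⟩
    · rintro ⟨i, j, hij, rfl⟩
      exact (hlink.1 (hq _ i j rfl hij)).1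
  · rintro ⟨p, q, h, rfl⟩
    refine ⟨completeEdges_subset h, simple_of_isLink (fun e x hx => ?_) fun e f x y he hf => ?_, p, h.inj,
      ?_, fun i j hij => ⟨_, hlink.2 ⟨mem_completeEdges.2 ⟨i, j, hij, rfl⟩, h.link i j hij⟩⟩⟩
    · obtain ⟨he, hx⟩ := hlink.1 hx
      obtain ⟨i, j, hij, rfl⟩ := mem_completeEdges.1 he
      rcases hx.eq_and_eq_or_eq_and_eq (h.link i j hij) with ⟨h1, h2⟩ | ⟨h1, h2⟩
      · exact hij (h.inj (h1.symm.trans h2))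
      · exact hij (h.inj (h2.symm.trans h1))
    · obtain ⟨he, hxe⟩ := hlink.1 he
      obtain ⟨hf, hxf⟩ := hlink.1 hf
      obtain ⟨i, j, hij, rfl⟩ := mem_completeEdges.1 he
      obtain ⟨k, l, hkl, rfl⟩ := mem_completeEdges.1 hf
      congr 1
      rcases hxe.eq_and_eq_or_eq_and_eq (h.link i j hij) with ⟨rfl, rfl⟩ | ⟨rfl, rfl⟩ <;>
        rcases hxf.eq_and_eq_or_eq_and_eq (h.link k l hkl) with ⟨h1, h2⟩ | ⟨h1, h2⟩ <;>
        rw [h.inj h1, h.inj h2]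
      · exact Sym2.eq_swap
      · exact Sym2.eq_swap
    · ext x
      constructor
      · rintro ⟨i, rfl⟩
        obtain ⟨j, hj⟩ : ∃ j : Fin r, i ≠ j := by
          by_cases h0 : i = ⟨0, by omega⟩
          · exact ⟨⟨1, by omega⟩, by simp [h0]⟩
          · exact ⟨_, h0⟩
        exact ⟨_, mem_completeEdges.2 ⟨i, j, hj, rfl⟩, (h.link i j hj).inc_left⟩
      · rintro ⟨e, he, hx⟩
        obtain ⟨i, j, hij, rfl⟩ := mem_completeEdges.1 he
        rcases hx.eq_or_eq_of_isLink (h.link i j hij) with rfl | rfl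
        · exact ⟨i, rfl⟩
        · exact ⟨j, rfl⟩

theorem induce_iso_complete_iff {S : Set α} :
    S ⊆ X.vertexSet ∧ Nonempty (Iso (X.induce S) (complete r)) ↔ S ⊆ X.vertexSet ∧
      ∃ p : Fin r → α, Function.Injective p ∧ Set.range p = S ∧
        (∀ i j, i ≠ j → X.Adj (p i) (p j)) ∧ (∀ e i, ¬ X.IsLink e (p i) (p i)) ∧
        ∀ e f i j, X.IsLink e (p i) (p j) → X.IsLink f (p i) (p j) → e = f := by
  rw [nonempty_iso_complete_iff]
  refine and_congr_right fun hS => ⟨?_, ?_⟩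
  · rintro ⟨hs, p, hp, hpV, hadj⟩
    have hpV' : Set.range p = S := hpV
    have hm : ∀ i, p i ∈ S := fun i => hpV' ▸ Set.mem_range_self i
    refine ⟨p, hp, hpV, fun i j hij => ?_, fun e i h => ?_, fun e f i j he hf => ?_⟩
    · obtain ⟨e, he⟩ := hadj i j hij
      exact ⟨e, he.1⟩
    · exact hs.not_isLoopAt e (p i) ⟨h, hm i, hm i⟩
    · exact hs.eq_of_isLink ⟨he, hm i, hm j⟩ ⟨hf, hm i, hm j⟩
  · rintro ⟨p, hp, rfl, hadj, hl, hpar⟩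
    refine ⟨simple_of_isLink ?_ ?_, p, hp, rfl, fun i j hij => ?_⟩
    · rintro e _ ⟨h, ⟨i, rfl⟩, -⟩
      exact hl e i h
    · rintro e f _ _ ⟨h, ⟨i, rfl⟩, ⟨j, rfl⟩⟩ ⟨h', -, -⟩
      exact hpar e f i j h h'
    · obtain ⟨e, he⟩ := hadj i j hij
      exact ⟨e, he, Set.mem_range_self i, Set.mem_range_self j⟩

theorem induce_iso_complete_iff_isFull (hr : 2 ≤ r) {S : Set α} :
    S ⊆ X.vertexSet ∧ Nonempty (Iso (X.induce S) (complete r)) ↔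
      ∃ (p : Fin r → α) (q : Sym2 (Fin r) → β), X.IsCompleteSub p q ∧ X.IsFull p q ∧
        S = Set.range p := by
  rw [induce_iso_complete_iff]
  constructor
  · rintro ⟨hS, p, hp, rfl, hadj, hl, hpar⟩
    obtain ⟨e₀, -⟩ := hadj ⟨0, by omega⟩ ⟨1, by omega⟩ (by simp)
    have hq : ∀ s : Sym2 (Fin r), ∃ e : β, ∀ i j, s = s(i, j) → i ≠ j →
        X.IsLink e (p i) (p j) := by
      intro s
      induction s with
      | h i j =>
        by_cases hij : i = j
        · subst hij
          refine ⟨e₀, fun k l hkl hne => ?_⟩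
          rcases Sym2.eq_iff.1 hkl with ⟨rfl, rfl⟩ | ⟨rfl, rfl⟩ <;> exact absurd rfl hne
        · obtain ⟨e, he⟩ := hadj i j hij
          refine ⟨e, fun k l hkl _ => ?_⟩
          rcases Sym2.eq_iff.1 hkl with ⟨rfl, rfl⟩ | ⟨rfl, rfl⟩
          · exact he
          · exact he.symm
    choose q hq using hq
    refine ⟨p, q, ⟨hp, fun i j => hq _ i j rfl⟩, fun e i j he => ?_, rfl⟩
    have hij : i ≠ j := by
      rintro rfl; exact hl e i he
    exact mem_completeEdges.2 ⟨i, j, hij, hpar _ _ i j (hq _ i j rfl hij) he⟩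
  · rintro ⟨p, q, h, hfull, rfl⟩
    have key : ∀ e i j, X.IsLink e (p i) (p j) → i ≠ j ∧ e = q s(i, j) := by
      intro e i j he
      obtain ⟨k, l, hkl, rfl⟩ := mem_completeEdges.1 (hfull e i j he)
      rcases he.eq_and_eq_or_eq_and_eq (h.link k l hkl) with ⟨h1, h2⟩ | ⟨h1, h2⟩
      · rw [h.inj h1, h.inj h2]; exact ⟨hkl, rfl⟩
      · rw [h.inj h1, h.inj h2, Sym2.eq_swap]; exact ⟨hkl.symm, rfl⟩
    refine ⟨?_, p, h.inj, rfl, fun i j hij => ⟨_, h.link i j hij⟩,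
      fun e i he => (key e i i he).1 rfl, fun e f i j he hf => ?_⟩
    · rintro _ ⟨i, rfl⟩
      obtain ⟨j, hj⟩ : ∃ j : Fin r, i ≠ j := by
        by_cases h0 : i = ⟨0, by omega⟩
        · exact ⟨⟨1, by omega⟩, by simp [h0]⟩
        · exact ⟨_, h0⟩
      exact (h.link i j hj).left_mem
    · rw [(key e i j he).2, (key f i j hf).2]

theorem edgeInducedCount_eq (hr : 2 ≤ r) : edgeInducedCount (complete r) X =
    {R : Set β | ∃ (p : Fin r → α) (q : Sym2 (Fin r) → β), X.IsCompleteSub p q ∧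
      R = completeEdges q}.ncard := by
  simp only [edgeInducedCount, edgeInduce_iso_complete_iff hr]

/-- Vertices carry no labels, so induced copies are counted by edges. Fullness makes the edge set
recoverable from the vertex set, and `r ≥ 2` leaves no vertex isolated. -/
theorem vertexInducedCount_eq (hr : 2 ≤ r) : vertexInducedCount (complete r) X =
    {R : Set β | ∃ (p : Fin r → α) (q : Sym2 (Fin r) → β), X.IsCompleteSub p q ∧ X.IsFull p q ∧
      R = completeEdges q}.ncard := by
  simp only [vertexInducedCount, induce_iso_complete_iff_isFull hr]
  symm
  have hS : ∀ {p : Fin r → α} {q : Sym2 (Fin r) → β}, X.IsCompleteSub p q →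
      {x | ∃ e ∈ completeEdges q, X.Inc e x} = Set.range p := by
    intro p q h
    ext x
    constructor
    · rintro ⟨e, he, hx⟩
      obtain ⟨i, j, hij, rfl⟩ := mem_completeEdges.1 he
      rcases hx.eq_or_eq_of_isLink (h.link i j hij) with rfl | rfl
      · exact ⟨i, rfl⟩
      · exact ⟨j, rfl⟩
    · rintro ⟨i, rfl⟩
      obtain ⟨j, hj⟩ : ∃ j : Fin r, i ≠ j := by
        by_cases h0 : i = ⟨0, by omega⟩
        · exact ⟨⟨1, by omega⟩, by simp [h0]⟩
        · exact ⟨_, h0⟩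
      exact ⟨_, mem_completeEdges.2 ⟨i, j, hj, rfl⟩, (h.link i j hj).inc_left⟩
  have hsub : ∀ {p p' : Fin r → α} {q q' : Sym2 (Fin r) → β}, X.IsCompleteSub p q →
      X.IsFull p' q' → Set.range p = Set.range p' → completeEdges q ⊆ completeEdges q' := by
    intro p p' q q' h hf hpp e he
    obtain ⟨i, j, hij, rfl⟩ := mem_completeEdges.1 he
    obtain ⟨k, hk⟩ : p i ∈ Set.range p' := hpp ▸ Set.mem_range_self i
    obtain ⟨l, hl⟩ : p j ∈ Set.range p' := hpp ▸ Set.mem_range_self j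
    exact hf _ k l (hk ▸ hl ▸ h.link i j hij)
  refine Set.ncard_congr (fun R _ => {x | ∃ e ∈ R, X.Inc e x}) ?_ ?_ ?_
  · rintro _ ⟨p, q, h, hf, rfl⟩
    exact ⟨p, q, h, hf, hS h⟩
  · rintro _ _ ⟨p, q, h, hf, rfl⟩ ⟨p', q', h', hf', rfl⟩ heq
    rw [hS h, hS h'] at heq
    exact (hsub h hf' heq).antisymm (hsub h' hf heq.symm)
  · rintro _ ⟨p, q, h, hf, rfl⟩
    exact ⟨_, ⟨p, q, h, hf, rfl⟩, hS h⟩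

theorem Simple.isFull (hX : X.Simple) {p : Fin r → α} {q : Sym2 (Fin r) → β}
    (h : X.IsCompleteSub p q) : X.IsFull p q := by
  intro e i j he
  have hij : i ≠ j := fun h0 => he.ne (congrArg p h0)
  exact mem_completeEdges.2 ⟨i, j, hij, (h.link i j hij).eq he⟩

theorem Simple.edgeInducedCount_eq_vertexInducedCount (hX : X.Simple) (hr : 2 ≤ r) :
    edgeInducedCount (complete r) X = vertexInducedCount (complete r) X := by
  rw [edgeInducedCount_eq hr, vertexInducedCount_eq hr]
  congr 1
  ext R
  exact ⟨fun ⟨p, q, h, hR⟩ => ⟨p, q, h, hX.isFull h, hR⟩, fun ⟨p, q, h, _, hR⟩ => ⟨p, q, h, hR⟩⟩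

end Complete

/-! ### Transfer of complete subgraphs and clique numbers. -/

section CompleteTransfer

variable {α β α' β' I : Type*} {X : Graph α β} {Y : Graph α' β'} {inv : I → I}
  {v : X.Arc → I} {w : Y.Arc → I} {r : ℕ}

theorem isLink_of_inc_of_ne {e : β} {x y : α} (hx : X.Inc e x) (hy : X.Inc e y) (h : x ≠ y) :
    X.IsLink e x y := by
  obtain ⟨z, hz⟩ := hx
  rcases hy.eq_or_eq_of_isLink hz with rfl | rfl
  · exact absurd rfl h
  · exact hz

theorem IsTriangle.exists_inc {e f g : β} (h : X.IsTriangle e f g) :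
    ∃ x, X.Inc e x ∧ X.Inc g x := by
  obtain ⟨x, y, z, -, -, -, h4, -, h6⟩ := h
  exact ⟨x, h4.inc_left, h6.inc_right⟩

/-- Three edges which meet pairwise without having a common vertex form a triangle. -/
theorem inc_or_isTriangle {e g d : β} {y z u : α} (hyz : y ≠ z) (hzu : z ≠ u)
    (huy : u ≠ y) (he : X.IsLink e y z) (hg : X.IsLink g u y) {s t : α} (hs : X.Inc e s)
    (hs' : X.Inc d s) (ht : X.Inc g t) (ht' : X.Inc d t) : X.Inc d y ∨ X.IsTriangle e d g := by
  rcases hs.eq_or_eq_of_isLink he with rfl | rfl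
  · exact Or.inl hs'
  rcases ht.eq_or_eq_of_isLink hg with rfl | rfl
  · exact Or.inr ⟨y, s, t, hyz, hzu, huy, he, isLink_of_inc_of_ne hs' ht' hzu, hg⟩
  · exact Or.inl ht'

/-- Complete subgraphs correspond to complete subgraphs. -/
theorem SameZeta.exists_isCompleteSub [Finite I] (h : SameZeta X Y inv v w) (hr : 3 ≤ r)
    {p : Fin r → α} {q : Sym2 (Fin r) → β} (hpq : X.IsCompleteSub p q) :
    ∃ (p' : Fin r → α') (q' : Sym2 (Fin r) → β'), Y.IsCompleteSub p' q' ∧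
      ∀ i j, i ≠ j → SameLabel v w (q s(i, j)) (q' s(i, j)) := by
  have hex : ∀ s : Sym2 (Fin r), ¬ s.IsDiag → ∃ e', SameLabel v w (q s) e' := by
    intro s
    induction s with
    | h i j =>
      intro hij
      obtain ⟨k, hki, hkj⟩ := exists_ne_ne hr i j
      obtain ⟨e', -, -, he, -⟩ := h.exists_triangle
        (hpq.isTriangle (i := i) (j := j) (by simpa using hij) hkj.symm hki)
      exact ⟨e', he⟩
  have hne : Nonempty β' := by
    obtain ⟨e', -⟩ := hex s(⟨0, by omega⟩, ⟨1, by omega⟩) (by simp)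
    exact ⟨e'⟩
  choose! q' hq' using hex
  have hlab : ∀ i j, i ≠ j → SameLabel v w (q s(i, j)) (q' s(i, j)) :=
    fun i j hij => hq' _ (by simpa using hij)
  have htri : ∀ i j k, i ≠ j → j ≠ k → k ≠ i →
      Y.IsTriangle (q' s(i, j)) (q' s(j, k)) (q' s(k, i)) := fun i j k hij hjk hki =>
    h.isTriangle (hpq.isTriangle hij hjk hki) (hlab i j hij) (hlab j k hjk) (hlab k i hki)
  have hvert : ∀ i, ∃ y, ∀ j, j ≠ i → Y.Inc (q' s(i, j)) y := by
    intro i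
    obtain ⟨j, hji, -⟩ := exists_ne_ne hr i i
    obtain ⟨k, hki, hkj⟩ := exists_ne_ne hr i j
    obtain ⟨y, z, u, hyz, hzu, huy, he, hf, hg⟩ := htri i j k hji.symm hkj.symm hki
    refine ⟨y, fun l hli => ?_⟩
    by_cases hlj : l = j
    · rw [hlj]; exact he.inc_left
    by_cases hlk : l = k
    · rw [hlk, Sym2.eq_swap]; exact hg.inc_right
    obtain ⟨s, hs, hs'⟩ := (htri i j l hji.symm (Ne.symm hlj) hli).exists_inc
    obtain ⟨t, ht, ht'⟩ := (htri i k l hki.symm (Ne.symm hlk) hli).exists_inc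
    rw [Sym2.eq_swap] at hs' ht' ht
    rcases inc_or_isTriangle hyz hzu huy he hg hs hs' ht ht' with h1 | h1
    · exact h1
    -- The exceptional triangle would come back to three edges of `X` through `p i`, which cannot
    -- form a triangle.
    · have h2 := h.symm.isTriangle h1 (hlab i j hji.symm).symm (hlab i l (Ne.symm hli)).symm
        (hlab k i hki).symm
      exact (h2.not_inc (hpq.link i j hji.symm).inc_left (hpq.link i l (Ne.symm hli)).inc_left
        (hpq.link k i hki).inc_right).elim
  choose p' hp' using hvert
  have hne : ∀ i j, i ≠ j → p' i ≠ p' j := by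
    intro i j hij h0
    obtain ⟨k, hki, hkj⟩ := exists_ne_ne hr i j
    refine (htri i j k hij hkj.symm hki).not_inc (hp' i j hij.symm) (h0 ▸ hp' j k hkj) ?_
    rw [Sym2.eq_swap]
    exact hp' i k hki
  refine ⟨p', q', ⟨fun i j => not_imp_not.1 (hne i j), fun i j hij => ?_⟩, hlab⟩
  refine isLink_of_inc_of_ne (hp' i j hij.symm) ?_ (hne i j hij)
  rw [Sym2.eq_swap]
  exact hp' j i hij

/-- An edge of `Y` between two of the vertices is a loop at a triangle or a side of one; in either
case its partner in `X` has its ends among the `p i`, so fullness of `X` applies. -/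
theorem SameZeta.isFull [Finite I] (h : SameZeta X Y inv v w) (hr : 3 ≤ r)
    {p : Fin r → α} {q : Sym2 (Fin r) → β} (hpq : X.IsCompleteSub p q) (hf : X.IsFull p q)
    {p' : Fin r → α'} {q' : Sym2 (Fin r) → β'} (hpq' : Y.IsCompleteSub p' q')
    (hlab : ∀ i j, i ≠ j → SameLabel v w (q s(i, j)) (q' s(i, j))) : Y.IsFull p' q' := by
  have hmem : ∀ {e e'}, SameLabel v w e e' → e ∈ completeEdges q → e' ∈ completeEdges q' := by
    intro e e' hee he
    obtain ⟨k, l, hkl, rfl⟩ := mem_completeEdges.1 he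
    exact mem_completeEdges.2 ⟨k, l, hkl, h.right_unique (hlab k l hkl) hee⟩
  intro e' i j he'
  by_cases hij : i = j
  · subst hij
    obtain ⟨j, hji, -⟩ := exists_ne_ne hr i i
    obtain ⟨k, hki, hkj⟩ := exists_ne_ne hr i j
    obtain ⟨l, t, hl, hlt, hinc⟩ := h.symm.exists_loop (hpq'.inj.ne hji.symm)
      (hpq'.inj.ne hkj.symm) (hpq'.inj.ne hki) (hpq'.link i j hji.symm) (hpq'.link j k hkj.symm)
      (hpq'.link k i hki) he' (hlab i j hji.symm).symm (hlab j k hkj.symm).symm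
      (hlab k i hki).symm
    have ht : ∃ m, t = p m := by
      rcases hinc with h1 | h1 | h1
      · exact (h1.eq_or_eq_of_isLink (hpq.link i j hji.symm)).elim (⟨_, ·⟩) (⟨_, ·⟩)
      · exact (h1.eq_or_eq_of_isLink (hpq.link j k hkj.symm)).elim (⟨_, ·⟩) (⟨_, ·⟩)
      · exact (h1.eq_or_eq_of_isLink (hpq.link k i hki)).elim (⟨_, ·⟩) (⟨_, ·⟩)
    obtain ⟨m, rfl⟩ := ht
    exact hmem hl.symm (hf l m m hlt)
  · obtain ⟨k, hki, hkj⟩ := exists_ne_ne hr i j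
    have h1 : Y.IsTriangle e' (q' s(j, k)) (q' s(k, i)) :=
      ⟨_, _, _, hpq'.inj.ne hij, hpq'.inj.ne hkj.symm, hpq'.inj.ne hki, he',
        hpq'.link j k hkj.symm, hpq'.link k i hki⟩
    obtain ⟨e, f, g, hee, hff, hgg, ht⟩ := h.symm.exists_triangle h1
    rw [h.symm.right_unique hff (hlab j k hkj.symm).symm,
      h.symm.right_unique hgg (hlab k i hki).symm] at ht
    obtain ⟨x, y, z, hxy, hyz, hzx, h4, h5, h6⟩ := ht
    have hxs := h6.right_eq_or_eq (hpq.link k i hki)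
    have hys := h5.left_eq_or_eq (hpq.link j k hkj.symm)
    refine hmem hee.symm ?_
    rcases hxs with rfl | rfl <;> rcases hys with rfl | rfl <;> exact hf _ _ _ h4

/-- An edge is determined by its partner, so transporting edge sets is injective when every edge
involved has one. -/
theorem ncard_le_of_sameLabel [Finite I] (h : SameZeta X Y inv v w) (A : Set (Set β))
    (B : Set (Set β')) (hB : ∀ R ∈ B, R ⊆ Y.edgeSet)
    (hA : ∀ R ∈ A, (∀ e ∈ R, ∃ e', SameLabel v w e e') ∧
      {e' | ∃ e ∈ R, SameLabel v w e e'} ∈ B) : A.ncard ≤ B.ncard := by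
  refine Set.ncard_le_ncard_of_injOn (fun R => {e' | ∃ e ∈ R, SameLabel v w e e'})
    (fun R hR => (hA R hR).2) ?_ (h.finite_right.finite_subsets.subset hB)
  have key : ∀ R ∈ A, ∀ R', {e' | ∃ e ∈ R, SameLabel v w e e'} =
      {e' | ∃ e ∈ R', SameLabel v w e e'} → R ⊆ R' := by
    intro R hR R' heq e he
    obtain ⟨e', he'⟩ := (hA R hR).1 e he
    obtain ⟨f, hf, hfe⟩ : e' ∈ {e' | ∃ e ∈ R', SameLabel v w e e'} := heq ▸ ⟨e, he, he'⟩
    rwa [h.symm.right_unique he'.symm hfe.symm]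
  exact fun R hR R' hR' heq => (key R hR R' heq).antisymm (key R' hR' R heq.symm)

theorem SameZeta.image_completeEdges (h : SameZeta X Y inv v w) {q : Sym2 (Fin r) → β}
    {q' : Sym2 (Fin r) → β'}
    (hlab : ∀ i j, i ≠ j → SameLabel v w (q s(i, j)) (q' s(i, j))) :
    (∀ e ∈ completeEdges q, ∃ e', SameLabel v w e e') ∧
      {e' | ∃ e ∈ completeEdges q, SameLabel v w e e'} = completeEdges q' := by
  constructor
  · intro e he
    obtain ⟨i, j, hij, rfl⟩ := mem_completeEdges.1 he
    exact ⟨_, hlab i j hij⟩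
  · ext e'
    constructor
    · rintro ⟨e, he, hee⟩
      obtain ⟨i, j, hij, rfl⟩ := mem_completeEdges.1 he
      exact mem_completeEdges.2 ⟨i, j, hij, h.right_unique (hlab i j hij) hee⟩
    · intro he
      obtain ⟨i, j, hij, rfl⟩ := mem_completeEdges.1 he
      exact ⟨_, mem_completeEdges.2 ⟨i, j, hij, rfl⟩, hlab i j hij⟩

theorem SameZeta.edgeInducedCount_le [Finite I] (h : SameZeta X Y inv v w) (hr : 3 ≤ r) :
    edgeInducedCount (complete r) X ≤ edgeInducedCount (complete r) Y := by
  rw [edgeInducedCount_eq (by omega), edgeInducedCount_eq (by omega)]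
  refine ncard_le_of_sameLabel h _ _ ?_ ?_
  · rintro _ ⟨p, q, hpq, rfl⟩
    exact completeEdges_subset hpq
  · rintro _ ⟨p, q, hpq, rfl⟩
    obtain ⟨p', q', hpq', hlab⟩ := h.exists_isCompleteSub hr hpq
    obtain ⟨h1, h2⟩ := h.image_completeEdges hlab
    exact ⟨h1, p', q', hpq', h2⟩

theorem SameZeta.vertexInducedCount_le [Finite I] (h : SameZeta X Y inv v w) (hr : 3 ≤ r) :
    vertexInducedCount (complete r) X ≤ vertexInducedCount (complete r) Y := by
  rw [vertexInducedCount_eq (by omega), vertexInducedCount_eq (by omega)]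
  refine ncard_le_of_sameLabel h _ _ ?_ ?_
  · rintro _ ⟨p, q, hpq, -, rfl⟩
    exact completeEdges_subset hpq
  · rintro _ ⟨p, q, hpq, hf, rfl⟩
    obtain ⟨p', q', hpq', hlab⟩ := h.exists_isCompleteSub hr hpq
    obtain ⟨h1, h2⟩ := h.image_completeEdges hlab
    exact ⟨h1, p', q', hpq', h.isFull hr hpq hf hpq' hlab, h2⟩

/-- The orders of the vertex-induced complete subgraphs. -/
def cliqueOrders (X : Graph α β) : Set ℕ :=
  {r : ℕ | ∃ S : Set α, S ⊆ X.vertexSet ∧ Nonempty (Iso (X.induce S) (complete r))}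

theorem SameZeta.mem_cliqueOrders [Finite I] (h : SameZeta X Y inv v w) (hr : 3 ≤ r)
    (hX : r ∈ X.cliqueOrders) : r ∈ Y.cliqueOrders := by
  obtain ⟨S, hS⟩ := hX
  obtain ⟨p, q, hpq, hf, -⟩ := (induce_iso_complete_iff_isFull (by omega)).1 hS
  obtain ⟨p', q', hpq', hlab⟩ := h.exists_isCompleteSub hr hpq
  exact ⟨_, (induce_iso_complete_iff_isFull (by omega)).2
    ⟨p', q', hpq', h.isFull hr hpq hf hpq' hlab, rfl⟩⟩

theorem bddAbove_cliqueOrders (hV : X.vertexSet.Finite) : BddAbove X.cliqueOrders := by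
  refine ⟨X.vertexSet.ncard, ?_⟩
  rintro r ⟨S, hS⟩
  obtain ⟨hS, p, hp, rfl, -⟩ := induce_iso_complete_iff.1 hS
  have h1 := Set.ncard_le_ncard hS hV
  rwa [← Set.image_univ, Set.ncard_image_of_injective _ hp, Set.ncard_univ, Nat.card_fin] at h1

theorem SameZeta.cliqueNumber_eq [Finite I] (h : SameZeta X Y inv v w)
    (hX : X.vertexSet.Finite) (hr : 3 ≤ r) (hXr : X.cliqueNumber = r) :
    Y.cliqueNumber = r := by
  have hne : X.cliqueOrders.Nonempty := by
    by_contra h0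
    rw [Set.not_nonempty_iff_eq_empty] at h0
    have : X.cliqueNumber = sSup X.cliqueOrders := rfl
    rw [h0, csSup_empty, hXr] at this
    simp only [bot_eq_zero'] at this
    omega
  have hmem : r ∈ X.cliqueOrders := hXr ▸ Nat.sSup_mem hne (bddAbove_cliqueOrders hX)
  have hle : ∀ s ∈ X.cliqueOrders, s ≤ r :=
    fun s hs => hXr ▸ le_csSup (bddAbove_cliqueOrders hX) hs
  refine IsGreatest.csSup_eq ⟨h.mem_cliqueOrders hr hmem, fun s hs => ?_⟩
  by_cases hs3 : 3 ≤ s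
  · exact hle s (h.symm.mem_cliqueOrders hs3 hs)
  -- Orders below 3 need not transfer, but they cannot exceed `r`.
  · omega

/-- The clique number of a nonempty simple graph without triangles. -/
theorem Simple.cliqueNumber_of_lt (hX : X.Simple) (hV : X.vertexSet.Finite)
    (hne : X.vertexSet.Nonempty) (h3 : X.cliqueNumber < 3) :
    (X.cliqueNumber = 2 ↔ X.edgeSet.Nonempty) ∧ (X.cliqueNumber = 1 ∨ X.cliqueNumber = 2) := by
  have hb := bddAbove_cliqueOrders hV
  have h1 : 1 ≤ X.cliqueNumber := by
    obtain ⟨x, hx⟩ := hne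
    refine le_csSup hb ⟨{x}, induce_iso_complete_iff.2 ⟨by simpa using hx, fun _ => x,
      Function.injective_of_subsingleton _, by simp, fun i j hij => absurd (Subsingleton.elim i j) hij,
      fun e _ he => he.ne rfl, fun e f _ _ he hf => he.eq hf⟩⟩
  have h0 : X.cliqueOrders.Nonempty := by
    by_contra h0
    rw [Set.not_nonempty_iff_eq_empty] at h0
    have : X.cliqueNumber = sSup X.cliqueOrders := rfl
    rw [h0, csSup_empty] at this
    simp only [bot_eq_zero'] at this
    omega
  refine ⟨⟨fun h2 => ?_, fun ⟨e, he⟩ => ?_⟩, by omega⟩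
  · have hmem : 2 ∈ X.cliqueOrders := h2 ▸ Nat.sSup_mem h0 hb
    obtain ⟨S, hS⟩ := hmem
    obtain ⟨-, p, -, -, hadj, -⟩ := induce_iso_complete_iff.1 hS
    obtain ⟨e, he⟩ := hadj 0 1 (by simp)
    exact ⟨e, he.edge_mem⟩
  · obtain ⟨x, y, hxy⟩ := X.exists_isLink_of_mem_edgeSet he
    have h2 : 2 ≤ X.cliqueNumber := by
      refine le_csSup hb ⟨{x, y}, induce_iso_complete_iff.2 ⟨?_, ![x, y], ?_, ?_, ?_,
        fun e _ he => he.ne rfl, fun e f _ _ he hf => he.eq hf⟩⟩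
      · rintro _ (rfl | rfl)
        · exact hxy.left_mem
        · exact hxy.right_mem
      · intro i j
        fin_cases i <;> fin_cases j <;> simp [hxy.ne, hxy.ne.symm]
      · simp [Set.pair_comm]
      · intro i j hij
        fin_cases i <;> fin_cases j <;> simp at hij ⊢
        · exact ⟨e, hxy⟩
        · exact ⟨e, hxy.symm⟩
    omega

end CompleteTransfer

end

end Graph

theorem mainTheorem3 {α β α' β' I : Type*} [Finite I]
    (X : Graph α β) (Y : Graph α' β')
    (hXV : X.vertexSet.Finite) (hXE : X.edgeSet.Finite) (hXne : X.vertexSet.Nonempty)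
    (hYV : Y.vertexSet.Finite) (hYE : Y.edgeSet.Finite) (hYne : Y.vertexSet.Nonempty)
    -- the variable attached to each arc, and the pairing of the variables of inverse arcs
    (inv : I → I) (varX : X.Arc → I) (varY : Y.Arc → I)
    (hvarX : Function.Injective varX) (hvarY : Function.Injective varY)
    (hinvX : ∀ a : X.Arc, varX a.inv = inv (varX a))
    (hinvY : ∀ a : Y.Arc, varY a.inv = inv (varY a))
    -- the two edge zeta functions agree near `0`
    (hzeta : ∀ᶠ u in nhds (0 : I → ℂ),
      X.edgeZeta (fun a => u (varX a)) = Y.edgeZeta (fun a => u (varY a))) :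
    (∀ r : ℕ, 3 ≤ r →
      Graph.edgeInducedCount (Graph.complete r) X = Graph.edgeInducedCount (Graph.complete r) Y ∧
      Graph.vertexInducedCount (Graph.complete r) X =
        Graph.vertexInducedCount (Graph.complete r) Y ∧
      (X.Simple →
        Graph.edgeInducedCount (Graph.complete r) X =
          Graph.vertexInducedCount (Graph.complete r) X) ∧
      (X.cliqueNumber = r ↔ Y.cliqueNumber = r)) ∧
    (X.Simple → Y.Simple → (X.edgeSet.Nonempty ↔ Y.edgeSet.Nonempty) →
      X.cliqueNumber = Y.cliqueNumber) := by
  have h : Graph.SameZeta X Y inv varX varY :=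
    ⟨hXE, hYE, hvarX, hvarY, hinvX, hinvY, hzeta⟩
  have hclique : ∀ r : ℕ, 3 ≤ r → (X.cliqueNumber = r ↔ Y.cliqueNumber = r) := fun r hr =>
    ⟨fun hX => h.cliqueNumber_eq hXV hr hX, fun hY => h.symm.cliqueNumber_eq hYV hr hY⟩
  refine ⟨fun r hr => ⟨(h.edgeInducedCount_le hr).antisymm (h.symm.edgeInducedCount_le hr),
    (h.vertexInducedCount_le hr).antisymm (h.symm.vertexInducedCount_le hr),
    fun hX => hX.edgeInducedCount_eq_vertexInducedCount (by omega), hclique r hr⟩,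
    fun hX hY hE => ?_⟩
  by_cases h3 : 3 ≤ X.cliqueNumber
  · exact ((hclique _ h3).1 rfl).symm
  by_cases h3' : 3 ≤ Y.cliqueNumber
  · exact (hclique _ h3').2 rfl
  obtain ⟨h1, h2⟩ := hX.cliqueNumber_of_lt hXV hXne (by omega)
  obtain ⟨h1', h2'⟩ := hY.cliqueNumber_of_lt hYV hYne (by omega)
  -- Both clique numbers are 1 or 2, and the value 2 is now attained simultaneously.
  rw [hE, ← h1'] at h1
  omega
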